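/- **Model.** A radio network is a connected undirected graph $G=(V,E)$ on at most $N$ nodes; it is *multi-hop* if $G$ is not complete. For a node $u$ let $n_u$ be its number of neighbors. Time is divided into synchronous slots and all nodes start in the same slot. The nodes are anonymous and all run the same randomized algorithm, with independent private randomness; the algorithm may depend on $N$. In each slot every node either broadcasts a message or listens, as a function of its private randomness and of what it has heard so far. A broadcasting node gets no feedback. A listening node hears silence if none of its neighbors broadcasts, and receives the message if exactly one of its neighbors broadcasts; if at least two of its neighbors broadcast, it hears noise when collision detection is available, and silence when it is not. Fix a constant $\tilde c\ge 1$. An algorithm *solves multi-hop all-nodes approximate neighbor counting within $T$ slots with probability $p$* for networks of at most $N$ nodes if, for every multi-hop network with at most $N$ nodes and every node $u$ of it, with probability at least $p$ node $u$ holds by the end of slot $T$ an estimate $\hat n_u$ with $n_u\le \hat n_u\le \tilde c\, n_u$. It does so *with high probability in $N$* if $p\ge 1-1/N^{\gamma}$ for some constant $\gamma\ge 1$. **Theorem.** In multi-hop radio networks containing at most $N$ nodes: - Without collision detection, solving all-nodes approximate neighbor counting with high probability in $N$ requires $\Omega(\lg^2 N)$ time in the worst case: there are $c>0$ and $N_0$,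 depending only on $\tilde c$, such that for all $N\ge N_0$ and $\gamma\ge1$, every algorithm that solves the problem for networks of at most $N$ nodes within $T$ slots with probability $1-1/N^{\gamma}$ has $T\ge c\lg^2 N$. - With collision detection, solving all-nodes approximate neighbor counting with high probability in $N$ requires $\Omega(\lg N)$ time in the worst case: there are $c>0$ and $N_0$, depending only on $\tilde c$, such that for all $N\ge N_0$ and $\gamma\ge1$, every algorithm that solves the problem for networks of at most $N$ nodes within $T$ slots with probability $1-1/N^{\gamma}$ has $T\ge c\lg N$. -/

import Mathlib

open MeasureTheory

namespace RadioNetwork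

/-- What the channel tells a node in one time slot: nothing about the channel if the node itself
broadcast (`sent`), otherwise silence, a received message, or noise (a detected collision). -/
inductive Feedback (Msg : Type) where
  | sent : Feedback Msg
  | silence : Feedback Msg
  | received (m : Msg) : Feedback Msg
  | noise : Feedback Msg

/-- A randomized distributed algorithm, executed by every node of an anonymous network.
Each node privately draws a random seed from the probability measure `law`, independently of the
others. Everything a node does is a function of its seed and of the list of channel feedbacks it
has obtained in the previous slots, latest slot first (the length of this list is the common
clock, and the earlier actions of the node are determined by its seed and this list). -/
structure Algorithm where
  /-- the possible messages -/
  Msg : Type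
  [countable_msg : Countable Msg]
  /-- the possible values of the private randomness of a node -/
  Seed : Type
  [seed_space : MeasurableSpace Seed]
  law : Measure Seed
  [isProbability_law : IsProbabilityMeasure law]
  /-- the action in the next slot: `some m` broadcasts `m`, and `none` listens -/
  act : Seed → List (Feedback Msg) → Option Msg
  measurable_act : ∀ (h : List (Feedback Msg)) (a : Option Msg), MeasurableSet {r | act r h = a}
  /-- the current estimate of the neighborhood size, where `none` means that there is none yet -/
  estimate : Seed → List (Feedback Msg) → Option ℝ
  measurable_estimate : ∀ (h : List (Feedback Msg)) (s : Set ℝ), MeasurableSet s →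
    MeasurableSet {r | ∃ x ∈ s, estimate r h = some x}

attribute [instance] Algorithm.countable_msg Algorithm.seed_space Algorithm.isProbability_law

variable {V : Type}

open Classical in
/-- The feedback of node `u` in a slot in which every node `v` performs the action `a v`. A
listening node receives a message iff exactly one of its neighbors broadcasts; if at least two
do, it hears noise when collision detection is available (`cd = true`), and silence otherwise. -/
noncomputable def feedback {Msg : Type} (cd : Bool) (G : SimpleGraph V) (a : V → Option Msg)
    (u : V) : Feedback Msg :=
  if a u ≠ none then .sent
  else if h : ∃! p : V × Msg, G.Adj u p.1 ∧ a p.1 = some p.2 then .received h.choose.2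
  else if cd = true ∧ ∃ v, G.Adj u v ∧ a v ≠ none then .noise
  else .silence

/-- The feedbacks that each node has obtained during the first `t` slots, latest slot first, when
all nodes start together, node `v` has the random seed `r v`, and the topology is `G`. -/
noncomputable def history (A : Algorithm) (cd : Bool) (G : SimpleGraph V) (r : V → A.Seed) :
    ℕ → V → List (Feedback A.Msg)
  | 0, _ => []
  | t + 1, u =>
      feedback cd G (fun v => A.act (r v) (history A cd G r t v)) u :: history A cd G r t u

/-- By the end of slot `T`, node `u` has an estimate `x` of its number `n_u` of neighbors such
that `n_u ≤ x ≤ cTilde * n_u`. -/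
def GoodEstimate (A : Algorithm) (cd : Bool) (G : SimpleGraph V) (cTilde : ℝ) (T : ℕ)
    (r : V → A.Seed) (u : V) : Prop :=
  ∃ x : ℝ, A.estimate (r u) (history A cd G r T u) = some x ∧
    ((G.neighborSet u).ncard : ℝ) ≤ x ∧ x ≤ cTilde * ((G.neighborSet u).ncard : ℝ)

/-- `A` solves approximate neighbor counting for all nodes within `T` slots with probability at
least `p` in the multi-hop networks with at most `N` nodes: for every connected topology on at
most `N` nodes that is not single-hop (i.e. not a complete graph), each individual node has a good
estimate by the end of slot `T` with probability at least `p`. -/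
def SolvesAllNodesCounting (A : Algorithm) (cd : Bool) (cTilde : ℝ) (N T : ℕ) (p : ℝ) : Prop :=
  ∀ n : ℕ, n ≤ N → ∀ G : SimpleGraph (Fin n), G.Connected → G ≠ ⊤ → ∀ u : Fin n,
    p ≤ (Measure.pi fun _ : Fin n => A.law).real {r | GoodEstimate A cd G cTilde T r u}

end RadioNetwork

namespace RadioNetwork

variable {V W : Type}

/-! ### The channel -/

section Feedback

variable {Msg : Type} {cd : Bool} {G : SimpleGraph V} {a : V → Option Msg} {u : V}

/-! The hard instances are stars, judged at their center. A large pool of seeds is drawn once, and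
each set `R` of pool nodes spans its own star, so all stars are coupled on one probability space. If
the center with a fixed seed has the same history in two stars whose sizes differ by more than the
factor `cTilde`, its single estimate is wrong in one of them. A history in which the center never
receives a message can be computed leaf by leaf (`pairRun`), and `history_star` identifies it with
the real one.

With collision detection there are at most `3 ^ T` such histories of the center, so among `3 ^ T *
K` leaves some `K` induce the same one. While the center listens, these leaves broadcast all
together or not at all, so any two of them look like all `K`. Hence every seed assignment has a
failing star of size `2` or `K`. A union bound over these polynomially many stars (in `3 ^ T`, for
fixed `K`) forces `3 ^ T` to be at least a power of `N`.

Without collision detection the center hears only silence as long as `R` meets no broadcaster set of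
a slot in exactly one element. Take `R` random of density `2 ^ (-i)`. `exists_levels` splits the
broadcaster sets at each scale into those to be avoided altogether and those large enough to be hit
twice. The resulting success probability is `exp (-cost)`, and each slot adds only a bounded amount
to the total cost over all scales. So each block of `I` scales contains one with success probability
at least `exp (-64 T / I)`. Two blocks separated by a gap give incompatible sizes under the same
history, and averaging over seeds and stars bounds this probability by about `I / N`. With `I` of
order `lg N` this forces `T` to be of order `lg² N`. -/

theorem feedback_eq_sent (h : a u ≠ none) : feedback cd G a u = .sent := by
  simp only [feedback, if_pos h]

theorem feedback_eq_received (h : a u = none) {v : V} {m : Msg} (hv : G.Adj u v)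
    (hm : a v = some m) (huniq : ∀ w, G.Adj u w → a w ≠ none → w = v) :
    feedback cd G a u = .received m := by
  have hex : ∃! p : V × Msg, G.Adj u p.1 ∧ a p.1 = some p.2 := by
    refine ⟨(v, m), ⟨hv, hm⟩, ?_⟩
    rintro ⟨w, m'⟩ ⟨hw, hm'⟩
    obtain rfl := huniq w hw (by simp_all)
    simp_all
  have hch : hex.choose = (v, m) :=
    hex.unique hex.choose_spec.1 ⟨hv, hm⟩
  simp only [feedback, h, ne_eq, not_true_eq_false, if_false, dif_pos hex, hch]

theorem feedback_eq_of_not_unique (h : a u = none)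
    (hn : ¬ ∃! p : V × Msg, G.Adj u p.1 ∧ a p.1 = some p.2)
    [Decidable (cd = true ∧ ∃ v, G.Adj u v ∧ a v ≠ none)] :
    feedback cd G a u =
      if cd = true ∧ ∃ v, G.Adj u v ∧ a v ≠ none then .noise else .silence := by
  simp only [feedback, h, ne_eq, not_true_eq_false, if_false, dif_neg hn]
  congr

theorem feedback_eq_silence (h : a u = none) (hs : ∀ v, G.Adj u v → a v = none) :
    feedback cd G a u = .silence := by
  classical
  rw [feedback_eq_of_not_unique h, if_neg]
  · rintro ⟨-, v, hv, hv'⟩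
    exact hv' (hs v hv)
  · rintro ⟨p, ⟨hp, hp'⟩, -⟩
    simp [hs _ hp] at hp'

theorem feedback_of_collision (h : a u = none) {v w : V} (hv : G.Adj u v) (hw : G.Adj u w)
    (hav : a v ≠ none) (haw : a w ≠ none) (hvw : v ≠ w) :
    feedback cd G a u = if cd = true then .noise else .silence := by
  classical
  rw [feedback_eq_of_not_unique h]
  · have : ∃ v, G.Adj u v ∧ a v ≠ none := ⟨v, hv, hav⟩
    simp only [this, and_true]
  · intro hex
    obtain ⟨m, hm⟩ := Option.ne_none_iff_exists'.1 hav
    obtain ⟨m', hm'⟩ := Option.ne_none_iff_exists'.1 haw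
    exact hvw (congrArg Prod.fst (hex.unique (y₁ := (v, m)) (y₂ := (w, m')) ⟨hv, hm⟩ ⟨hw, hm'⟩))

/-- The feedback of a node depends only on the nodes in a set containing its neighborhood. -/
theorem feedback_comap (G : SimpleGraph W) (f : V ↪ W) (a : W → Option Msg) (u : V)
    (hf : ∀ w, G.Adj (f u) w → w ∈ Set.range f) :
    feedback cd (G.comap f) (fun v => a (f v)) u = feedback cd G a (f u) := by
  classical
  by_cases h : a (f u) = none
  swap
  · rw [feedback_eq_sent (a := a) h, feedback_eq_sent (a := fun v => a (f v)) h]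
  by_cases hex : ∃! p : W × Msg, G.Adj (f u) p.1 ∧ a p.1 = some p.2
  · obtain ⟨⟨w, m⟩, ⟨hw, hm⟩, huniq⟩ := hex
    obtain ⟨v, rfl⟩ := hf w hw
    have key : ∀ w', G.Adj (f u) w' → a w' ≠ none → w' = f v := by
      intro w' hw' ha
      obtain ⟨m', hm'⟩ := Option.ne_none_iff_exists'.1 ha
      exact congrArg Prod.fst (huniq (w', m') ⟨hw', hm'⟩)
    rw [feedback_eq_received h hw hm key,
      feedback_eq_received (a := fun v => a (f v)) (u := u) h (v := v) hw hm
        fun w' hw' ha => f.injective (key _ hw' ha)]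
  · have hex' : ¬ ∃! p : V × Msg, (G.comap f).Adj u p.1 ∧ a (f p.1) = some p.2 := by
      rintro ⟨⟨v, m⟩, ⟨hv, hm⟩, huniq⟩
      refine hex ⟨(f v, m), ⟨hv, hm⟩, ?_⟩
      rintro ⟨w, m'⟩ ⟨hw, hm'⟩
      obtain ⟨v', rfl⟩ := hf w hw
      have := huniq (v', m') ⟨hw, hm'⟩
      simp_all
    rw [feedback_eq_of_not_unique h hex, feedback_eq_of_not_unique (a := fun v => a (f v)) h hex']
    congr 1
    refine propext (and_congr_right fun _ => ⟨fun ⟨v, hv⟩ => ⟨f v, hv⟩, fun ⟨w, hw, hw'⟩ => ?_⟩)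
    obtain ⟨v, rfl⟩ := hf w hw
    exact ⟨v, hw, hw'⟩

end Feedback

theorem history_comap (A : Algorithm) (cd : Bool) (G : SimpleGraph W) (f : V ↪ W)
    (hf : ∀ u w, G.Adj (f u) w → w ∈ Set.range f) (r : W → A.Seed) (t : ℕ) (u : V) :
    history A cd (G.comap f) (fun v => r (f v)) t u = history A cd G r t (f u) := by
  induction t generalizing u with
  | zero => rfl
  | succ t ih =>
    simp only [history, ih]
    congr 1
    exact feedback_comap G f (fun w => A.act (r w) (history A cd G r t w)) u (hf u)

theorem goodEstimate_comap (A : Algorithm) (cd : Bool) (G : SimpleGraph W) (f : V ↪ W)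
    (hf : ∀ u w, G.Adj (f u) w → w ∈ Set.range f) (c : ℝ) (T : ℕ) (r : W → A.Seed) (u : V) :
    GoodEstimate A cd (G.comap f) c T (fun v => r (f v)) u ↔ GoodEstimate A cd G c T r (f u) := by
  have : G.neighborSet (f u) = f '' (G.comap f).neighborSet u := by
    ext w
    constructor
    · intro hw
      obtain ⟨v, rfl⟩ := hf u w hw
      exact ⟨v, hw, rfl⟩
    · rintro ⟨v, hv, rfl⟩
      exact hv
  simp only [GoodEstimate, history_comap A cd G f hf, this, Set.ncard_image_of_injective _ f.injective]

/-! ### Measurability of the outcome -/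

instance {Msg : Type} [Countable Msg] : Countable (Feedback Msg) := by
  refine Function.Injective.countable (β := Option (Option (Option (Option Msg))))
    (f := fun x => match x with
      | .sent => none
      | .silence => some none
      | .noise => some (some none)
      | .received m => some (some (some (some m)))) ?_
  intro x y h
  cases x <;> cases y <;> simp_all

/-- There are countably many messages and finitely many nodes, so each slot's joint action takes
countably many values and any function of it is measurable. -/
theorem measurableSet_history (A : Algorithm) (cd : Bool) [Finite V] (G : SimpleGraph V) (t : ℕ)
    (u : V) (h : List (Feedback A.Msg)) :
    MeasurableSet {r : V → A.Seed | history A cd G r t u = h} := by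
  induction t generalizing u h with
  | zero =>
    simp only [history]
    exact MeasurableSet.const _
  | succ t ih =>
    let _ : MeasurableSpace (Option A.Msg) := ⊤
    let _ : MeasurableSpace (Feedback A.Msg) := ⊤
    have hact : ∀ (v : V) (m : Option A.Msg),
        MeasurableSet {r : V → A.Seed | A.act (r v) (history A cd G r t v) = m} := by
      intro v m
      have : {r : V → A.Seed | A.act (r v) (history A cd G r t v) = m} =
          ⋃ h : List (Feedback A.Msg), {r | history A cd G r t v = h} ∩
            (fun r : V → A.Seed => r v) ⁻¹' {s | A.act s h = m} := by
        ext r; simp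
      rw [this]
      exact MeasurableSet.iUnion fun h =>
        (ih v h).inter (measurable_pi_apply v (A.measurable_act h m))
    have hm : Measurable fun (r : V → A.Seed) (v : V) => A.act (r v) (history A cd G r t v) :=
      measurable_pi_lambda _ fun v => measurable_to_countable' fun m => hact v m
    have hfb : Measurable fun r : V → A.Seed =>
        feedback cd G (fun v => A.act (r v) (history A cd G r t v)) u :=
      (measurable_of_countable fun a : V → Option A.Msg => feedback cd G a u).comp hm
    cases h with
    | nil => simp [history]
    | cons x h =>
      simp only [history, List.cons.injEq, Set.ofPred_and]
      exact (hfb (MeasurableSpace.measurableSet_top (s := {x}))).inter (ih u h)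

theorem measurableSet_goodEstimate (A : Algorithm) (cd : Bool) [Finite V] (G : SimpleGraph V)
    (c : ℝ) (T : ℕ) (u : V) :
    MeasurableSet {r : V → A.Seed | GoodEstimate A cd G c T r u} := by
  set d : ℝ := ((G.neighborSet u).ncard : ℝ) with hd
  have : {r : V → A.Seed | GoodEstimate A cd G c T r u} =
      ⋃ h : List (Feedback A.Msg), {r | history A cd G r T u = h} ∩
        (fun r : V → A.Seed => r u) ⁻¹' {s | ∃ x ∈ Set.Icc d (c * d), A.estimate s h = some x} := by
    ext r
    simp only [GoodEstimate, Set.mem_ofPred_eq, Set.mem_iUnion, Set.mem_inter_iff, Set.mem_preimage,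
      exists_eq_left', Set.mem_Icc, ← hd]
    exact exists_congr fun x => and_comm
  rw [this]
  exact MeasurableSet.iUnion fun h => (measurableSet_history A cd G T u h).inter
    (measurable_pi_apply u (A.measurable_estimate h _ measurableSet_Icc))

/-- Restricting independent seeds to some of the nodes leaves independent seeds; this is what lets
all stars share one pool. -/
theorem pi_map_comp_embedding {S : Type} [MeasurableSpace S] (μ : Measure S)
    [IsProbabilityMeasure μ] [Fintype V] [Fintype W] (f : V ↪ W) :
    (Measure.pi fun _ : W => μ).map (fun r v => r (f v)) = Measure.pi fun _ : V => μ := by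
  classical
  refine (Measure.pi_eq fun s hs => ?_).symm
  rw [Measure.map_apply (by fun_prop) (MeasurableSet.univ_pi hs)]
  have : (fun (r : W → S) v => r (f v)) ⁻¹' Set.univ.pi s =
      Set.univ.pi fun w => ⋂ v, ⋂ _ : f v = w, s v := by
    ext r
    simp only [Set.mem_preimage, Set.mem_pi, Set.mem_univ, true_imp_iff, Set.mem_iInter]
    exact ⟨fun h w v hv => hv ▸ h v, fun h v => h _ v rfl⟩
  rw [this, Measure.pi_pi]
  symm
  refine Finset.prod_of_injOn f f.injective.injOn (by simp) ?_ ?_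
  · intro w _ hw
    have : (⋂ v, ⋂ _ : f v = w, s v) = Set.univ := by
      refine Set.iInter_eq_univ.2 fun v => Set.iInter_eq_univ.2 fun hv => ?_
      exact absurd ⟨v, by simp, hv⟩ hw
    rw [this, measure_univ]
  · intro v _
    congr 1
    ext x
    simp [f.injective.eq_iff]

/-! ### Stars in a pool of nodes -/

variable {α : Type}

/-- The star with center `none` whose leaves are the members of `R`; all other nodes are
isolated. -/
def star (R : Finset α) : SimpleGraph (Option α) :=
  SimpleGraph.fromRel fun x y => x = none ∧ ∃ v ∈ R, y = some v

@[simp] theorem star_adj_none_some {R : Finset α} {v : α} :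
    (star R).Adj none (some v) ↔ v ∈ R := by
  simp [star]

@[simp] theorem star_adj_some_none {R : Finset α} {v : α} :
    (star R).Adj (some v) none ↔ v ∈ R := by
  simp [star]

@[simp] theorem star_adj_some_some {R : Finset α} {v w : α} :
    ¬ (star R).Adj (some v) (some w) := by
  simp [star]

theorem star_neighborSet_none (R : Finset α) : (star R).neighborSet none = some '' (R : Set α) := by
  ext x
  cases x <;> simp

theorem star_neighborSet_none_ncard (R : Finset α) : ((star R).neighborSet none).ncard = R.card := by
  rw [star_neighborSet_none, Set.ncard_image_of_injective _ (Option.some_injective _),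
    Set.ncard_coe_finset]

/-- An algorithm for networks of at most `N` nodes rarely errs at the center of a star with at most
`N` nodes, even if the seeds of the star are part of a larger pool of seeds. -/
theorem SolvesAllNodesCounting.measure_star_le {A : Algorithm} {cd : Bool} {c : ℝ} {N T : ℕ}
    {ε : ℝ} (hA : SolvesAllNodesCounting A cd c N T (1 - ε)) [Fintype α] (R : Finset α)
    (h2 : 2 ≤ R.card) (hN : R.card + 1 ≤ N) :
    (Measure.pi fun _ : Option α => A.law).real {r | ¬ GoodEstimate A cd (star R) c T r none} ≤ ε := by
  classical
  have hcard : Fintype.card (Option R) = R.card + 1 := by simp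
  -- The star without the isolated pool nodes, relabelled by `Fin`, is the network to which the
  -- hypothesis applies.
  let e : Fin (R.card + 1) ≃ Option R := (Fintype.equivFinOfCardEq hcard).symm
  let f : Fin (R.card + 1) ↪ Option α :=
    e.toEmbedding.trans (Function.Embedding.optionMap (Function.Embedding.subtype _))
  have hf_none : f (e.symm none) = none := by simp [f]
  have hf_some : ∀ v : R, f (e.symm (some v)) = some v.1 := fun v => by simp [f]
  have hrange : ∀ v ∈ R, some v ∈ Set.range f := fun v hv => ⟨_, hf_some ⟨v, hv⟩⟩
  have hcases : ∀ i, i = e.symm none ∨ ∃ v : R, i = e.symm (some v) := by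
    intro i
    obtain ⟨x, rfl⟩ := e.symm.surjective i
    cases x with
    | none => exact Or.inl rfl
    | some v => exact Or.inr ⟨v, rfl⟩
  have hf : ∀ u w, (star R).Adj (f u) w → w ∈ Set.range f := by
    intro u w h
    cases w with
    | none => exact ⟨_, hf_none⟩
    | some v =>
      rcases hcases u with rfl | ⟨v', rfl⟩
      · rw [hf_none, star_adj_none_some] at h
        exact hrange v h
      · rw [hf_some] at h
        exact absurd h star_adj_some_some
  have hconn : ((star R).comap f).Connected := by
    have : ∀ i, ((star R).comap f).Reachable (e.symm none) i := by
      intro i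
      rcases hcases i with rfl | ⟨v, rfl⟩
      · exact SimpleGraph.Reachable.refl _
      · refine SimpleGraph.Adj.reachable ?_
        rw [SimpleGraph.comap_adj, hf_none, hf_some, star_adj_none_some]
        exact v.2
    exact ⟨fun i j => (this i).symm.trans (this j)⟩
  -- Two leaves are never adjacent, so two leaves already make the star multi-hop.
  have htop : (star R).comap f ≠ ⊤ := by
    obtain ⟨v, hv, w, hw, hvw⟩ := Finset.one_lt_card.1 h2
    intro h
    have hadj : ((star R).comap f).Adj (e.symm (some ⟨v, hv⟩)) (e.symm (some ⟨w, hw⟩)) := by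
      rw [h, SimpleGraph.top_adj]
      simpa using hvw
    rw [SimpleGraph.comap_adj, hf_some, hf_some] at hadj
    exact star_adj_some_some hadj
  have key := hA _ hN _ hconn htop (e.symm none)
  have hm := measurableSet_goodEstimate A cd ((star R).comap f) c T (e.symm none)
  rw [← pi_map_comp_embedding A.law f, measureReal_def, Measure.map_apply (by fun_prop) hm,
    ← measureReal_def] at key
  have hset : (fun (r : Option α → A.Seed) v => r (f v)) ⁻¹'
      {r | GoodEstimate A cd ((star R).comap f) c T r (e.symm none)} =
      {r | GoodEstimate A cd (star R) c T r none} := by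
    ext r
    simp only [Set.mem_preimage, Set.mem_ofPred_eq]
    rw [goodEstimate_comap A cd (star R) f hf, hf_none]
  rw [hset] at key
  have hc := probReal_compl_eq_one_sub (μ := Measure.pi fun _ : Option α => A.law)
    (measurableSet_goodEstimate A cd (star R) c T none)
  have hset' : {r : Option α → A.Seed | ¬ GoodEstimate A cd (star R) c T r none} =
      {r | GoodEstimate A cd (star R) c T r none}ᶜ := rfl
  rw [hset', hc]
  linarith

/-! ### Virtual runs of a center and a single leaf -/

/-- The histories of the center (with seed `rc`) and of a leaf (with seed `rl`) of a star in which
the center never receives a message: with collision detection the center hears noise whenever the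
leaf broadcasts, and otherwise it always hears silence. -/
def pairRun (A : Algorithm) (cd : Bool) (rc rl : A.Seed) :
    ℕ → List (Feedback A.Msg) × List (Feedback A.Msg)
  | 0 => ([], [])
  | t + 1 =>
    let p := pairRun A cd rc rl t
    ((if (A.act rc p.1).isSome then .sent
      else if cd && (A.act rl p.2).isSome then .noise else .silence) :: p.1,
     (if (A.act rl p.2).isSome then .sent
      else match A.act rc p.1 with
        | some m => .received m
        | none => .silence) :: p.2)

variable {A : Algorithm} {cd : Bool} {rc rl rl' : A.Seed}

theorem pairRun_fst_eq_of_le {t T : ℕ} (htT : t ≤ T)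
    (h : (pairRun A cd rc rl T).1 = (pairRun A cd rc rl' T).1) :
    (pairRun A cd rc rl t).1 = (pairRun A cd rc rl' t).1 := by
  induction T, htT using Nat.le_induction with
  | base => exact h
  | succ T _ ih =>
    simp only [pairRun, List.cons.injEq] at h
    exact ih h.2

/-- Without collision detection the virtual history of the center is independent of the leaf. -/
theorem pairRun_false_fst (t : ℕ) :
    (pairRun A false rc rl t).1 = (pairRun A false rc rl' t).1 := by
  induction t with
  | zero => rfl
  | succ t ih => simp [pairRun, ih]

/-- With collision detection the virtual history of the center reveals whether the leaf
broadcasts in a slot in which the center listens. -/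
theorem pairRun_true_sends {t : ℕ}
    (h : (pairRun A true rc rl (t + 1)).1 = (pairRun A true rc rl' (t + 1)).1)
    (hc : A.act rc (pairRun A true rc rl t).1 = none)
    (hl : A.act rl (pairRun A true rc rl t).2 ≠ none) :
    A.act rl' (pairRun A true rc rl' t).2 ≠ none := by
  have ht := pairRun_fst_eq_of_le (Nat.le_succ t) h
  intro hl'
  simp only [pairRun, List.cons.injEq, ← ht, hc, hl'] at h
  have := Option.isSome_iff_ne_none.2 hl
  simp [this] at h

/-- Each slot adds one of only three feedbacks, because no message is ever received; the size of the
message alphabet is irrelevant. -/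
theorem exists_finset_pairRun_fst (A : Algorithm) (cd : Bool) (t : ℕ) :
    ∃ s : Finset (List (Feedback A.Msg)), s.card ≤ 3 ^ t ∧
      ∀ rc rl, (pairRun A cd rc rl t).1 ∈ s := by
  classical
  induction t with
  | zero => exact ⟨{[]}, by simp, fun _ _ => by simp [pairRun]⟩
  | succ t ih =>
    obtain ⟨s, hs, hmem⟩ := ih
    refine ⟨Finset.image₂ List.cons {.sent, .noise, .silence} s, ?_, fun rc rl => ?_⟩
    · refine (Finset.card_image₂_le _ _ _).trans ?_
      rw [pow_succ']
      exact Nat.mul_le_mul Finset.card_le_three hs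
    · refine Finset.mem_image₂.2 ⟨_, ?_, _, hmem rc rl, rfl⟩
      split_ifs <;> simp

/-- If the virtual runs of all leaves of a star look the same to the center, and no leaf is ever
the only one to broadcast while the center listens, then the virtual runs are the real ones. -/
theorem history_star {α : Type} {r : Option α → A.Seed} {R : Finset α} {T : ℕ}
    (hagree : ∀ v ∈ R, ∀ w ∈ R, (pairRun A cd (r none) (r (some v)) T).1 =
      (pairRun A cd (r none) (r (some w)) T).1)
    (halone : ∀ t < T, ∀ v ∈ R, A.act (r none) (pairRun A cd (r none) (r (some v)) t).1 = none →
      A.act (r (some v)) (pairRun A cd (r none) (r (some v)) t).2 ≠ none →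
      ∃ w ∈ R, w ≠ v ∧ A.act (r (some w)) (pairRun A cd (r none) (r (some w)) t).2 ≠ none)
    {t : ℕ} (ht : t ≤ T) {v : α} (hv : v ∈ R) :
    history A cd (star R) r t none = (pairRun A cd (r none) (r (some v)) t).1 ∧
      history A cd (star R) r t (some v) = (pairRun A cd (r none) (r (some v)) t).2 := by
  induction t generalizing v with
  | zero => exact ⟨rfl, rfl⟩
  | succ t ih =>
    replace ih := fun {v} (hv : v ∈ R) => ih (Nat.le_of_succ_le ht) (v := v) hv
    set a : Option α → Option A.Msg := fun x => A.act (r x) (history A cd (star R) r t x) with ha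
    have hac : ∀ {v}, v ∈ R → a none = A.act (r none) (pairRun A cd (r none) (r (some v)) t).1 :=
      fun hv => by rw [ha]; simp only [(ih hv).1]
    have hal : ∀ {v}, v ∈ R →
        a (some v) = A.act (r (some v)) (pairRun A cd (r none) (r (some v)) t).2 :=
      fun hv => by rw [ha]; simp only [(ih hv).2]
    simp only [history, pairRun, (ih hv).1, (ih hv).2, ← hac hv, ← hal hv, List.cons.injEq, and_true]
    constructor
    · by_cases hc : a none = none
      swap
      · rw [feedback_eq_sent hc, if_pos (Option.isSome_iff_ne_none.2 hc)]
      rw [if_neg (by simp [hc])]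
      by_cases hs : ∃ w ∈ R, a (some w) ≠ none
      · obtain ⟨w, hw, hws⟩ := hs
        obtain ⟨w', hw', hne, hws'⟩ := halone t ht w hw (by rw [← hac hw, hc]) (by rwa [← hal hw])
        rw [← hal hw'] at hws'
        rw [feedback_of_collision (v := some w) (w := some w') hc (by simpa) (by simpa) hws hws'
          (by simpa using hne.symm)]
        cases cd with
        | false => simp
        | true =>
          -- The center's views agree, so if `w` broadcasts then so does `v`, and the noise in the
          -- virtual run of `v` is the real noise.
          have := pairRun_true_sends (pairRun_fst_eq_of_le ht (hagree w hw v hv))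
            (by rw [← hac hw, hc]) (by rwa [← hal hw])
          rw [← hal hv] at this
          simp [Option.isSome_iff_ne_none, this]
      · push Not at hs
        rw [feedback_eq_silence hc, if_neg (by simp [hs v hv])]
        rintro (_ | w) hw
        · exact hc
        · exact hs w (by simpa using hw)
    · by_cases hl : a (some v) = none
      swap
      · rw [feedback_eq_sent hl, if_pos (Option.isSome_iff_ne_none.2 hl)]
      rw [if_neg (by simp [hl])]
      have hadj : ∀ x, (star R).Adj (some v) x → x = none := by
        rintro (_ | w) hw
        · rfl
        · exact absurd hw star_adj_some_some
      cases hc : a none with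
      | none => exact feedback_eq_silence hl fun x hx => hadj x hx ▸ hc
      | some m => exact feedback_eq_received hl (v := none) (by simpa) hc fun x hx _ => hadj x hx

/-! ### Collision detection -/

/-- Pigeonhole on the center's virtual histories: an estimate at least `K` for the large star
exceeds `c * 2` for the small one. -/
theorem exists_not_goodEstimate_of_collisionDetection {α : Type} [Fintype α] {c : ℝ} {K T : ℕ}
    (h2K : 2 ≤ K) (hK : c * 2 < K) (hα : 3 ^ T * K ≤ Fintype.card α) (r : Option α → A.Seed) :
    ∃ R : Finset α, (R.card = K ∨ R.card = 2) ∧ ¬ GoodEstimate A true (star R) c T r none := by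
  classical
  obtain ⟨s, hs, hmem⟩ := exists_finset_pairRun_fst A true T
  have hne : s.Nonempty := ⟨_, hmem (r none) (r none)⟩
  obtain ⟨h, -, hh⟩ := Finset.exists_le_card_fiber_of_mul_le_card_of_maps_to
    (s := (Finset.univ : Finset α)) (t := s) (n := K)
    (f := fun v => (pairRun A true (r none) (r (some v)) T).1)
    (fun v _ => hmem _ _) hne ((Nat.mul_le_mul_right K hs).trans hα)
  obtain ⟨R, hR, hRK⟩ := Finset.exists_subset_card_eq hh
  obtain ⟨R', hR', hR2⟩ := Finset.exists_subset_card_eq (h2K.trans_eq hRK.symm)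
  have key : ∀ Q ⊆ R, 2 ≤ Q.card → history A true (star Q) r T none = h := by
    intro Q hQ hQ2
    have hQh : ∀ v ∈ Q, (pairRun A true (r none) (r (some v)) T).1 = h := fun v hv =>
      (Finset.mem_filter.1 (hR (hQ hv))).2
    have hagree : ∀ v ∈ Q, ∀ w ∈ Q, (pairRun A true (r none) (r (some v)) T).1 =
        (pairRun A true (r none) (r (some w)) T).1 := fun v hv w hw => by rw [hQh v hv, hQh w hw]
    obtain ⟨v, hv⟩ := Finset.card_pos.1 (by omega : 0 < Q.card)
    rw [(history_star hagree (fun t ht v hv hc hl => ?_) le_rfl hv).1, hQh v hv]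
    obtain ⟨w, hw, hwv⟩ := Finset.exists_mem_ne hQ2 v
    exact ⟨w, hw, hwv, pairRun_true_sends (pairRun_fst_eq_of_le ht (hagree v hv w hw)) hc hl⟩
  by_contra hgood
  push Not at hgood
  obtain ⟨x, hx, hx1, -⟩ := hgood R (Or.inl hRK)
  obtain ⟨y, hy, -, hy2⟩ := hgood R' (Or.inr hR2)
  rw [star_neighborSet_none_ncard, hRK] at hx1
  rw [star_neighborSet_none_ncard, hR2] at hy2
  rw [key R subset_rfl (by omega)] at hx
  rw [key R' hR' (by omega), hx] at hy
  obtain rfl : x = y := by simpa using hy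
  push_cast at hy2
  linarith

/-- Union bound: the failure events of all stars of size `K` or `2` in the pool cover the whole seed
space. -/
theorem le_of_solves_collisionDetection {c : ℝ} {K N T : ℕ} {ε : ℝ} (hε : 0 ≤ ε)
    (hA : SolvesAllNodesCounting A true c N T (1 - ε)) (h2K : 2 ≤ K) (hK : c * 2 < K)
    (hN : K + 1 ≤ N) : 1 ≤ 2 * ((3 : ℝ) ^ T * K) ^ K * ε := by
  classical
  set M := 3 ^ T * K with hM
  let F : Finset (Finset (Fin M)) :=
    Finset.powersetCard K Finset.univ ∪ Finset.powersetCard 2 Finset.univ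
  have hF : F.card ≤ 2 * M ^ K := by
    refine (Finset.card_union_le _ _).trans ?_
    rw [Finset.card_powersetCard, Finset.card_powersetCard, Finset.card_univ, Fintype.card_fin]
    have h1 : M.choose 2 ≤ M ^ K :=
      (Nat.choose_le_pow _ _).trans (Nat.pow_le_pow_right (by positivity) h2K)
    have h2 := Nat.choose_le_pow M K
    omega
  have hcover : (Set.univ : Set (Option (Fin M) → A.Seed)) ⊆
      ⋃ R ∈ F, {r | ¬ GoodEstimate A true (star R) c T r none} := by
    intro r _
    obtain ⟨R, hR, hbad⟩ := exists_not_goodEstimate_of_collisionDetection (α := Fin M) (T := T) h2K hK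
      (by simp [hM]) r
    simp only [Set.mem_iUnion]
    exact ⟨R, by simpa [F, Finset.mem_powersetCard] using hR, hbad⟩
  have hsum := (measureReal_mono (μ := Measure.pi fun _ : Option (Fin M) => A.law) hcover
    (measure_ne_top _ _)).trans
    (measureReal_biUnion_finset_le F _)
  rw [probReal_univ] at hsum
  refine hsum.trans ((Finset.sum_le_card_nsmul F _ ε fun R hR => ?_).trans ?_)
  · have : R.card = K ∨ R.card = 2 := by simpa [F, Finset.mem_powersetCard] using hR
    exact hA.measure_star_le R (by omega) (by omega)
  · rw [nsmul_eq_mul]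
    refine mul_le_mul_of_nonneg_right ?_ hε
    calc (F.card : ℝ) ≤ ((2 * M ^ K : ℕ) : ℝ) := by exact_mod_cast hF
      _ = _ := by rw [hM]; push_cast; ring

theorem SolvesAllNodesCounting.mono_prob {c : ℝ} {N T : ℕ} {p q : ℝ} (hpq : q ≤ p)
    (hA : SolvesAllNodesCounting A cd c N T p) : SolvesAllNodesCounting A cd c N T q :=
  fun n hn G h1 h2 u => hpq.trans (hA n hn G h1 h2 u)

theorem SolvesAllNodesCounting.of_one_le_exponent {c : ℝ} {N T : ℕ} {γ : ℝ} (hN : 1 ≤ N) (hγ : 1 ≤ γ)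
    (hA : SolvesAllNodesCounting A cd c N T (1 - 1 / (N : ℝ) ^ γ)) :
    SolvesAllNodesCounting A cd c N T (1 - 1 / (N : ℝ)) := by
  refine hA.mono_prob (sub_le_sub_left ?_ _)
  have h1 : (1 : ℝ) ≤ N := by exact_mod_cast hN
  exact one_div_le_one_div_of_le (by linarith) (Real.self_le_rpow_of_one_le h1 hγ)

theorem collisionDetection_lower_bound (cTilde : ℝ) :
    ∃ c : ℝ, 0 < c ∧ ∃ N₀ : ℕ, ∀ N : ℕ, N₀ ≤ N → ∀ γ : ℝ, 1 ≤ γ →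
      ∀ (A : Algorithm) (T : ℕ),
        SolvesAllNodesCounting A true cTilde N T (1 - 1 / (N : ℝ) ^ γ) →
          c * Real.logb 2 N ≤ T := by
  obtain ⟨K, hK⟩ := exists_nat_gt (max 2 (cTilde * 2))
  have h2K : 2 < K := by exact_mod_cast (le_max_left _ _).trans_lt hK
  have hKc : cTilde * 2 < K := (le_max_right _ _).trans_lt hK
  have hK0 : (0 : ℝ) < K := by exact_mod_cast (by omega : 0 < K)
  -- The second threshold makes `2 * K ^ K` at most the square root of `N`; with `3 ≤ 4` the bound
  -- becomes `N ≤ 2 ^ (4 * T * K)`.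
  refine ⟨1 / (4 * K), by positivity, max (K + 1) ((2 * K ^ K) ^ 2), fun N hN γ hγ A T hA => ?_⟩
  have hN1 : K + 1 ≤ N := (le_max_left _ _).trans hN
  have hN2 : (2 * K ^ K) ^ 2 ≤ N := (le_max_right _ _).trans hN
  have hN0 : (0 : ℝ) < N := by exact_mod_cast (by omega : 0 < N)
  have h := le_of_solves_collisionDetection (by positivity)
    (hA.of_one_le_exponent (by omega) hγ) h2K.le hKc hN1
  have hle : (N : ℝ) ^ 2 ≤ N * (2 ^ (2 * T * K) : ℝ) ^ 2 := by
    have h1 : (N : ℝ) ≤ 2 * ((3 : ℝ) ^ T * K) ^ K := by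
      have := mul_le_mul_of_nonneg_right h hN0.le
      field_simp at this
      simpa using this
    have h2 : 2 * ((3 : ℝ) ^ T * K) ^ K ≤ (2 * (K : ℝ) ^ K) * 2 ^ (2 * T * K) := by
      have : ((3 : ℝ) ^ T) ^ K ≤ ((4 : ℝ) ^ T) ^ K := by gcongr; norm_num
      have h4 : ((4 : ℝ) ^ T) ^ K = 2 ^ (2 * T * K) := by
        rw [show (4 : ℝ) = 2 ^ 2 by norm_num, ← pow_mul, ← pow_mul, mul_assoc]
      rw [mul_pow, ← h4]
      nlinarith [pow_pos hK0 K]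
    have h3 : ((2 * (K : ℝ) ^ K)) ^ 2 ≤ N := by exact_mod_cast hN2
    calc (N : ℝ) ^ 2 ≤ ((2 * (K : ℝ) ^ K) * 2 ^ (2 * T * K)) ^ 2 := by
          gcongr; exact h1.trans h2
      _ = (2 * (K : ℝ) ^ K) ^ 2 * (2 ^ (2 * T * K)) ^ 2 := by ring
      _ ≤ _ := by gcongr
  have hle' : (N : ℝ) ≤ 2 ^ (4 * T * K) := by
    have h5 : (N : ℝ) * N ≤ N * 2 ^ (4 * T * K) := by
      calc (N : ℝ) * N = N ^ 2 := by ring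
        _ ≤ _ := hle
        _ = _ := by rw [← pow_mul]; congr 2; ring
    exact le_of_mul_le_mul_left h5 hN0
  have hlog : Real.logb 2 N ≤ 4 * T * K := by
    rw [Real.logb_le_iff_le_rpow (by norm_num) hN0]
    have : (4 * T * K : ℝ) = ((4 * T * K : ℕ) : ℝ) := by push_cast; ring
    rwa [this, Real.rpow_natCast]
  rw [div_mul_eq_mul_div, one_mul, div_le_iff₀ (by positivity)]
  linarith

/-! ### Levels of a family of sets -/

/-- Take a maximal family in which each added set pays for at most `n` new elements; a set outside
with at most `n` new elements could still be added. -/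
theorem exists_absorbing_superset {α τ : Type} [DecidableEq α] [Fintype τ] [DecidableEq τ]
    (S : τ → Finset α) (A₀ : Finset τ) (n : ℕ) :
    ∃ A, A₀ ⊆ A ∧ (A.biUnion S).card ≤ (A₀.biUnion S).card + n * (A \ A₀).card ∧
      ∀ t ∉ A, n < (S t \ A.biUnion S).card := by
  let P : Finset τ → Prop := fun A =>
    A₀ ⊆ A ∧ (A.biUnion S).card ≤ (A₀.biUnion S).card + n * (A \ A₀).card
  have hP : ∃ A, P A := ⟨A₀, subset_rfl, by simp⟩
  obtain ⟨A, hA⟩ := (Set.toFinite {A | P A}).exists_maximal hP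
  refine ⟨A, hA.prop.1, hA.prop.2, fun t ht => ?_⟩
  by_contra! hle
  have hins : P (insert t A) := by
    refine ⟨hA.prop.1.trans (Finset.subset_insert _ _), ?_⟩
    have htA₀ : t ∉ A₀ := fun h => ht (hA.prop.1 h)
    rw [Finset.biUnion_insert, Finset.insert_sdiff_of_notMem _ htA₀,
      Finset.card_insert_of_notMem (by simp [ht]), ← Finset.sdiff_union_self_eq_union]
    have h1 := Finset.card_union_le (S t \ A.biUnion S) (A.biUnion S)
    have h2 := hA.prop.2
    rw [mul_add]
    omega
  exact ht (hA.le_of_ge hins (Finset.subset_insert _ _) (Finset.mem_insert_self _ _))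

/-- Every finite family of sets has levels such that the union of the sets of level at most `n` is
small, and every other set has many elements outside of this union. -/
theorem exists_levels {α τ : Type} [DecidableEq α] [Fintype τ] (S : τ → Finset α) :
    ∃ θ : τ → ℕ, ∀ n : ℕ,
      ((Finset.univ.filter (θ · ≤ n)).biUnion S).card ≤ ∑ t with θ t ≤ n, θ t ∧
      ∀ t, n < θ t → θ t ≤ (S t \ (Finset.univ.filter (θ · ≤ n)).biUnion S).card := by
  classical
  choose f hsub hcard habs using exists_absorbing_superset S
  -- Absorb with growing thresholds; the level of a set is the first stage that contains it.
  obtain ⟨A, hA0, hAs⟩ : ∃ A : ℕ → Finset τ, A 0 = f ∅ 0 ∧ ∀ n, A (n + 1) = f (A n) (n + 1) :=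
    ⟨fun n => Nat.rec (f ∅ 0) (fun n B => f B (n + 1)) n, rfl, fun _ => rfl⟩
  have hmono : Monotone A := monotone_nat_of_le_succ fun n => by rw [hAs]; exact hsub _ _
  have habsA : ∀ n, ∀ t ∉ A n, n < (S t \ (A n).biUnion S).card := by
    intro n
    cases n with
    | zero => rw [hA0]; exact habs _ _
    | succ n => rw [hAs]; exact habs _ _
  have hex : ∀ t, ∃ n, ∀ m, t ∈ A m ↔ n ≤ m := by
    intro t
    have h : ∃ n, t ∈ A n := by
      refine ⟨(S t).card, ?_⟩
      by_contra h
      exact absurd (habsA _ t h) (Finset.card_le_card Finset.sdiff_subset).not_gt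
    exact ⟨Nat.find h, fun m => ⟨fun hm => Nat.find_min' h hm, fun hm => hmono hm (Nat.find_spec h)⟩⟩
  choose θ hθ' using hex
  replace hθ' : ∀ n t, t ∈ A n ↔ θ t ≤ n := fun n t => hθ' t n
  have hθ : ∀ n, Finset.univ.filter (θ · ≤ n) = A n := fun n => by ext t; simp [hθ']
  refine ⟨θ, fun n => ⟨?_, fun t ht => ?_⟩⟩
  · rw [hθ]
    induction n with
    | zero => rw [hA0]; exact (hcard ∅ 0).trans (by simp)
    | succ n ih =>
      rw [hAs]
      refine (hcard _ _).trans ?_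
      rw [← hAs, ← Finset.sum_sdiff (hmono n.le_succ), add_comm]
      refine add_le_add (Eq.le ?_) ih
      rw [Finset.sum_congr rfl (g := fun _ => n + 1), Finset.sum_const, smul_eq_mul, mul_comm]
      intro t ht
      rw [Finset.mem_sdiff, hθ', hθ'] at ht
      omega
  · rw [hθ]
    obtain ⟨m, hm⟩ : ∃ m, θ t = m + 1 := Nat.exists_eq_add_of_lt ht |>.imp' (n + ·) fun k hk => hk
    -- Just before its own stage `m + 1` the set still had more than `m` elements outside the union,
    -- and the union at stage `n ≤ m` is smaller.
    have h1 := habsA m t (by rw [hθ']; omega)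
    have h2 : (S t \ (A m).biUnion S).card ≤ (S t \ (A n).biUnion S).card :=
      Finset.card_le_card (Finset.sdiff_subset_sdiff subset_rfl
        (Finset.biUnion_subset_biUnion_of_subset_left _ (hmono (by omega))))
    omega

/-! ### Random subsets -/

section Bernoulli

variable {α : Type} [Fintype α] [DecidableEq α]

/-- The probability of the outcome `R` when every `v` is included independently with probability
`p v`. -/
noncomputable def bernoulliWeight (p : α → ℝ) (R : Finset α) : ℝ :=
  ∏ v, if v ∈ R then p v else 1 - p v

/-- The probability of the event `E` when every `v` is included independently with probability
`p v`. -/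
noncomputable def bernoulliProb (p : α → ℝ) (E : Set (Finset α)) : ℝ :=
  ∑ R, bernoulliWeight p R * E.indicator 1 R

variable {p : α → ℝ}

theorem bernoulliWeight_nonneg (h0 : ∀ v, 0 ≤ p v) (h1 : ∀ v, p v ≤ 1) (R : Finset α) :
    0 ≤ bernoulliWeight p R :=
  Finset.prod_nonneg fun v _ => by split_ifs; exacts [h0 v, sub_nonneg.2 (h1 v)]

theorem sum_prod_mem_ite (f g : α → ℝ) :
    ∑ R : Finset α, ∏ v, (if v ∈ R then f v else g v) = ∏ v, (f v + g v) := by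
  rw [Finset.prod_add, Finset.powerset_univ]
  refine Finset.sum_congr rfl fun R _ => ?_
  rw [Finset.prod_ite]
  congr 2 <;> ext <;> simp

theorem sum_bernoulliWeight (p : α → ℝ) : ∑ R, bernoulliWeight p R = 1 := by
  simp only [bernoulliWeight, sum_prod_mem_ite]
  simp

theorem sum_bernoulliWeight_mul_pow_card_inter_le {q z : ℝ} {D : Finset α} (hp : ∀ v ∈ D, p v = q)
    (hq : 0 ≤ 1 + q * (z - 1)) :
    ∑ R, bernoulliWeight p R * z ^ (R ∩ D).card ≤ Real.exp (q * (z - 1) * D.card) := by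
  have h : ∀ R : Finset α, bernoulliWeight p R * z ^ (R ∩ D).card =
      ∏ v, if v ∈ R then p v * (if v ∈ D then z else 1) else 1 - p v := by
    intro R
    have : z ^ (R ∩ D).card = ∏ v, if v ∈ R then (if v ∈ D then z else 1) else 1 := by
      simp [Finset.prod_const]
    rw [this, bernoulliWeight, ← Finset.prod_mul_distrib]
    exact Finset.prod_congr rfl fun v _ => by split_ifs <;> simp
  simp only [h, sum_prod_mem_ite]
  have h' : ∀ v, p v * (if v ∈ D then z else 1) + (1 - p v) =
      if v ∈ D then 1 + q * (z - 1) else 1 := by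
    intro v
    split_ifs with hv
    · rw [hp v hv]; ring
    · ring
  simp only [h', Finset.prod_ite, Finset.prod_const_one, mul_one, Finset.prod_const,
    Finset.filter_mem_eq_inter, Finset.univ_inter]
  calc (1 + q * (z - 1)) ^ D.card ≤ Real.exp (q * (z - 1)) ^ D.card := by
        gcongr
        linarith [Real.add_one_le_exp (q * (z - 1))]
    _ = _ := by rw [← Real.exp_nat_mul, mul_comm]

/-- The lattice condition of the FKG inequality, with equality since the weight is a product. -/
theorem bernoulliWeight_mul (p : α → ℝ) (R Q : Finset α) :
    bernoulliWeight p R * bernoulliWeight p Q =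
      bernoulliWeight p (R ⊓ Q) * bernoulliWeight p (R ⊔ Q) := by
  simp only [bernoulliWeight, ← Finset.prod_mul_distrib]
  refine Finset.prod_congr rfl fun v _ => ?_
  by_cases h1 : v ∈ R <;> by_cases h2 : v ∈ Q <;> simp [h1, h2, mul_comm]

theorem bernoulliProb_univ (p : α → ℝ) : bernoulliProb p Set.univ = 1 := by
  simp [bernoulliProb, sum_bernoulliWeight]

/-- Positive correlation of increasing events. -/
theorem prod_bernoulliProb_le {τ : Type} (h0 : ∀ v, 0 ≤ p v) (h1 : ∀ v, p v ≤ 1) (s : Finset τ)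
    (E : τ → Set (Finset α)) (hE : ∀ t, IsUpperSet (E t)) :
    ∏ t ∈ s, bernoulliProb p (E t) ≤ bernoulliProb p (⋂ t ∈ s, E t) := by
  classical
  induction s using Finset.induction_on with
  | empty => simp [bernoulliProb_univ]
  | insert t s ht ih =>
    have hnonneg : ∀ F : Set (Finset α), (0 : Finset α → ℝ) ≤ F.indicator 1 :=
      fun F => Set.indicator_nonneg fun _ _ => zero_le_one
    have hmono : ∀ F : Set (Finset α), IsUpperSet F → Monotone (F.indicator (1 : Finset α → ℝ)) := by
      intro F hF R Q hRQ
      by_cases hR : R ∈ F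
      · simp [hR, hF hRQ hR]
      · simp only [Set.indicator_of_notMem hR]
        exact hnonneg F Q
    have hP : 0 ≤ bernoulliProb p (E t) := Finset.sum_nonneg fun R _ =>
      mul_nonneg (bernoulliWeight_nonneg h0 h1 R) (hnonneg _ R)
    have hU : IsUpperSet (⋂ t ∈ s, E t) := isUpperSet_iInter₂ fun t _ => hE t
    rw [Finset.prod_insert ht, Finset.set_biInter_insert]
    refine (mul_le_mul_of_nonneg_left ih hP).trans ?_
    have := fkg (μ := bernoulliWeight p) (f := (E t).indicator 1)
      (g := (⋂ t ∈ s, E t).indicator 1) (hμ₀ := bernoulliWeight_nonneg h0 h1) (hf₀ := hnonneg _)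
      (hg₀ := hnonneg _) (hf := hmono _ (hE t)) (hg := hmono _ hU)
      (hμ := fun R Q => (bernoulliWeight_mul p R Q).le)
    rw [sum_bernoulliWeight, one_mul] at this
    refine this.trans_eq (Finset.sum_congr rfl fun R _ => ?_)
    rw [Set.inter_indicator_one, Pi.mul_apply]

theorem one_sub_exp_le_bernoulliProb_two_le {q : ℝ} {D : Finset α} (h0 : ∀ v, 0 ≤ p v)
    (h1 : ∀ v, p v ≤ 1) (hp : ∀ v ∈ D, p v = q) (hq1 : q ≤ 1) :
    1 - 2 * Real.exp (-(q * D.card / 2)) ≤ bernoulliProb p {R | 2 ≤ (R ∩ D).card} := by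
  have key := sum_bernoulliWeight_mul_pow_card_inter_le (z := 1 / 2) hp (by linarith)
  -- The minorant `1 - 2 * (1 / 2) ^ k` is negative at `k = 0`, zero at `k = 1` and below `1`
  -- afterwards; its mean is an exponential moment.
  have hle : ∀ R : Finset α, 1 - 2 * (1 / 2 : ℝ) ^ (R ∩ D).card ≤
      ({R | 2 ≤ (R ∩ D).card} : Set (Finset α)).indicator 1 R := by
    intro R
    by_cases h : 2 ≤ (R ∩ D).card
    · rw [Set.indicator_of_mem (by exact h), Pi.one_apply]
      have : (0 : ℝ) ≤ (1 / 2 : ℝ) ^ (R ∩ D).card := by positivity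
      linarith
    · rw [Set.indicator_of_notMem (by exact h)]
      have h' : (R ∩ D).card ≤ 1 := by omega
      have : (1 / 2 : ℝ) ^ 1 ≤ (1 / 2 : ℝ) ^ (R ∩ D).card :=
        pow_le_pow_of_le_one (by norm_num) (by norm_num) h'
      linarith
  have hsum : ∑ R, bernoulliWeight p R * (1 - 2 * (1 / 2 : ℝ) ^ (R ∩ D).card) ≤
      bernoulliProb p {R | 2 ≤ (R ∩ D).card} :=
    Finset.sum_le_sum fun R _ => mul_le_mul_of_nonneg_left (hle R) (bernoulliWeight_nonneg h0 h1 R)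
  refine le_trans ?_ hsum
  have : ∑ R, bernoulliWeight p R * (1 - 2 * (1 / 2 : ℝ) ^ (R ∩ D).card) =
      1 - 2 * ∑ R, bernoulliWeight p R * (1 / 2 : ℝ) ^ (R ∩ D).card := by
    simp only [mul_sub, mul_one, Finset.sum_sub_distrib, sum_bernoulliWeight, Finset.mul_sum]
    exact congrArg (1 - ·) (Finset.sum_congr rfl fun R _ => by ring)
  rw [this]
  have hexp : q * (1 / 2 - 1) * D.card = -(q * D.card / 2) := by ring
  rw [hexp] at key
  linarith

/-- Markov's inequality for an exponential moment of the number of included elements. -/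
theorem bernoulliProb_mul_le_exp {q z a : ℝ} (hq0 : 0 ≤ q) (hq1 : q ≤ 1) (hz : 0 ≤ z)
    {E : Set (Finset α)} (hE : ∀ R ∈ E, a ≤ z ^ R.card) :
    bernoulliProb (fun _ : α => q) E * a ≤ Real.exp (q * (z - 1) * Fintype.card α) := by
  have key := sum_bernoulliWeight_mul_pow_card_inter_le (p := fun _ : α => q) (z := z)
    (D := Finset.univ) (fun _ _ => rfl) (by nlinarith)
  simp only [Finset.inter_univ, Finset.card_univ] at key
  refine le_trans ?_ key
  rw [bernoulliProb, Finset.sum_mul]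
  refine Finset.sum_le_sum fun R _ => ?_
  rw [mul_assoc]
  refine mul_le_mul_of_nonneg_left ?_ (bernoulliWeight_nonneg (fun _ => hq0) (fun _ => hq1) R)
  by_cases h : R ∈ E
  · simpa [h] using hE R h
  · simpa [h] using pow_nonneg hz _

theorem bernoulliProb_three_mul_le_card {q : ℝ} {e : ℕ} (hq0 : 0 ≤ q) (hq1 : q ≤ 1)
    (he : q * Fintype.card α = e) :
    bernoulliProb (fun _ : α => q) {R | 3 * e ≤ R.card} ≤ (4 / 5) ^ e := by
  have h := bernoulliProb_mul_le_exp (α := α) (z := 2) (a := 8 ^ e) (E := {R | 3 * e ≤ R.card}) hq0 hq1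
    (by norm_num) fun R hR => by
      rw [show (8 : ℝ) = 2 ^ 3 by norm_num, ← pow_mul]
      exact pow_le_pow_right₀ (by norm_num) hR
  have h2 : Real.exp (q * (2 - 1) * Fintype.card α) ≤ (4 / 5 * 8) ^ e := by
    rw [show q * (2 - 1) * Fintype.card α = e * 1 by linarith, Real.exp_nat_mul]
    gcongr
    linarith [Real.exp_one_lt_d9]
  rw [mul_pow] at h2
  exact le_of_mul_le_mul_right (h.trans h2) (by positivity)

theorem bernoulliProb_four_mul_card_le {q : ℝ} {e : ℕ} (hq0 : 0 ≤ q) (hq1 : q ≤ 1)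
    (he : q * Fintype.card α = e) :
    bernoulliProb (fun _ : α => q) {R | 4 * R.card ≤ e} ≤ (4 / 5) ^ e := by
  -- With `z = 1 / 16` the ratio per unit of `e` is `2 * exp (-15 / 16)`, just below `4 / 5`.
  have h := bernoulliProb_mul_le_exp (α := α) (z := 1 / 16) (a := (1 / 2) ^ e)
    (E := {R | 4 * R.card ≤ e}) hq0 hq1 (by norm_num) fun R hR => by
      rw [show (1 / 16 : ℝ) = (1 / 2) ^ 4 by norm_num, ← pow_mul]
      exact pow_le_pow_of_le_one (by norm_num) (by norm_num) hR
  have h2 : Real.exp (q * (1 / 16 - 1) * Fintype.card α) ≤ (4 / 5 * (1 / 2)) ^ e := by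
    rw [show q * (1 / 16 - 1) * Fintype.card α = e * (-(15 / 16)) by rw [← he]; ring,
      Real.exp_nat_mul]
    gcongr
    rw [Real.exp_neg, show (15 / 16 : ℝ) = 1 + -(1 / 16) by norm_num, Real.exp_add]
    have h3 := Real.exp_one_gt_d9
    have h4 := Real.add_one_le_exp (-(1 / 16) : ℝ)
    rw [inv_le_comm₀ (by positivity) (by norm_num)]
    nlinarith
  rw [mul_pow] at h2
  exact le_of_mul_le_mul_right (h.trans h2) (by positivity)

theorem bernoulliProb_sub_le (h0 : ∀ v, 0 ≤ p v) (h1 : ∀ v, p v ≤ 1) (E F : Set (Finset α)) :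
    bernoulliProb p E - bernoulliProb p F ≤ bernoulliProb p (E \ F) := by
  simp only [bernoulliProb, ← Finset.sum_sub_distrib, ← mul_sub]
  refine Finset.sum_le_sum fun R _ => mul_le_mul_of_nonneg_left ?_ (bernoulliWeight_nonneg h0 h1 R)
  by_cases hE : R ∈ E <;> by_cases hF : R ∈ F <;> simp [hE, hF]

/-! ### Families of sets that are hit exactly once -/

variable {τ : Type} [Fintype τ]

/-- The sets of elements that hit no member of the family `S` exactly once. -/
def hitNoneOnce (S : τ → Finset α) : Set (Finset α) := {R | ∀ t, (R ∩ S t).card ≠ 1}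

theorem exp_neg_two_mul_le_one_sub {q : ℝ} (h0 : 0 ≤ q) (h1 : q ≤ 1 / 2) :
    Real.exp (-(2 * q)) ≤ 1 - q := by
  have h := Real.add_one_le_exp (2 * q)
  rw [Real.exp_neg, inv_le_comm₀ (by positivity) (by linarith)]
  refine le_trans ?_ h
  rw [inv_le_iff_one_le_mul₀ (by linarith)]
  nlinarith

theorem exp_neg_inv_le_one_sub {y : ℝ} (hy : 1 ≤ y) :
    Real.exp (-(1 / y)) ≤ 1 - 2 * Real.exp (-(4 * y)) := by
  have hy0 : 0 < y := by linarith
  have hx : 1 / y ≤ 1 := by rw [div_le_one hy0]; exact hy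
  have hx0 : 0 < 1 / y := by positivity
  have h1 : Real.exp (-(1 / y)) ≤ 1 - 1 / y / 2 := by
    have := exp_neg_two_mul_le_one_sub (q := 1 / y / 2) (by positivity) (by linarith)
    rwa [mul_div_cancel₀ _ (by norm_num)] at this
  have h2 : Real.exp (-(4 * y)) ≤ 1 / y / 4 := by
    have := Real.add_one_le_exp (4 * y)
    rw [Real.exp_neg, div_div, ← one_div]
    exact one_div_le_one_div_of_le (by positivity) (by linarith)
  linarith

/-- Avoiding `B` altogether reduces to random subsets of the complement of `B`. -/
theorem pow_mul_bernoulliProb_le {q : ℝ} (h0 : 0 ≤ q) (h1 : q ≤ 1) (B : Finset α)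
    {E F : Set (Finset α)} (h : ∀ R, Disjoint R B → R ∈ F → R ∈ E) :
    (1 - q) ^ B.card * bernoulliProb (fun v => if v ∈ B then 0 else q) F ≤
      bernoulliProb (fun _ => q) E := by
  rw [bernoulliProb, bernoulliProb, Finset.mul_sum]
  refine Finset.sum_le_sum fun R _ => ?_
  have hw0 := bernoulliWeight_nonneg (p := fun _ : α => q) (fun _ => h0) (fun _ => h1) R
  have hrhs : 0 ≤ bernoulliWeight (fun _ => q) R * E.indicator 1 R :=
    mul_nonneg hw0 (Set.indicator_nonneg (fun _ _ => zero_le_one) R)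
  by_cases hF : R ∈ F
  swap
  · simpa [hF] using hrhs
  by_cases hRB : Disjoint R B
  · simp only [Set.indicator_of_mem hF, Set.indicator_of_mem (h R hRB hF), Pi.one_apply, mul_one]
    have : (1 - q) ^ B.card = ∏ v, if v ∈ B then 1 - q else 1 := by
      simp [Finset.prod_const]
    rw [this, bernoulliWeight, bernoulliWeight, ← Finset.prod_mul_distrib]
    refine Eq.le (Finset.prod_congr rfl fun v _ => ?_)
    by_cases hv : v ∈ R
    · have := Finset.disjoint_left.1 hRB hv
      simp [hv, this]
    · by_cases hv' : v ∈ B <;> simp [hv, hv']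
  · obtain ⟨v, hv, hvB⟩ := Finset.not_disjoint_iff.1 hRB
    have : bernoulliWeight (fun v => if v ∈ B then 0 else q) R = 0 :=
      Finset.prod_eq_zero (Finset.mem_univ v) (by simp [hv, hvB])
    simpa [this] using hrhs

/-- Avoid the union `B` of the low sets, and hit every high set at least twice outside `B`. The
first costs about `q * |B|`; the second events are increasing, hence positively correlated. The
choice `q * n = 8` puts the switch where the two entries of the minimum coincide. -/
theorem exp_le_bernoulliProb_hitNoneOnce {S : τ → Finset α} {θ : τ → ℕ} {n : ℕ}
    (hθ : ((Finset.univ.filter (θ · ≤ n)).biUnion S).card ≤ ∑ t with θ t ≤ n, θ t ∧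
      ∀ t, n < θ t → θ t ≤ (S t \ (Finset.univ.filter (θ · ≤ n)).biUnion S).card)
    {q : ℝ} (h0 : 0 < q) (h1 : q ≤ 1 / 2) (hn : q * n = 8) :
    Real.exp (-(16 * ∑ t, min (q * θ t / 8) (8 / (q * θ t)))) ≤
      bernoulliProb (fun _ => q) (hitNoneOnce S) := by
  classical
  obtain ⟨hB, habs⟩ := hθ
  set B := (Finset.univ.filter (θ · ≤ n)).biUnion S with hBdef
  set p : α → ℝ := fun v => if v ∈ B then 0 else q with hp
  have hp0 : ∀ v, 0 ≤ p v := fun v => by simp only [hp]; split_ifs <;> linarith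
  have hp1 : ∀ v, p v ≤ 1 := fun v => by simp only [hp]; split_ifs <;> linarith
  set E : τ → Set (Finset α) := fun t => {R | 2 ≤ (R ∩ (S t \ B)).card} with hE
  have hupper : ∀ t, IsUpperSet (E t) := fun t R Q hRQ hR =>
    le_trans hR (Finset.card_le_card (Finset.inter_subset_inter_right hRQ))
  set s := Finset.univ.filter fun t => ¬ θ t ≤ n with hs
  have hle := pow_mul_bernoulliProb_le h0.le (by linarith) B (E := hitNoneOnce S)
    (F := ⋂ t ∈ s, E t) fun R hRB hR t => by
      by_cases ht : θ t ≤ n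
      · have hSB : S t ⊆ B := Finset.subset_biUnion_of_mem S (by simp [ht])
        rw [Finset.disjoint_iff_inter_eq_empty.1 (hRB.mono_right hSB)]
        simp
      · have h2 : 2 ≤ (R ∩ (S t \ B)).card := Set.mem_iInter₂.1 hR t (by simpa [hs] using ht)
        have := h2.trans (Finset.card_le_card
          (Finset.inter_subset_inter subset_rfl (Finset.sdiff_subset (s := S t) (t := B))))
        omega
  have hlow : Real.exp (-(16 * ∑ t with θ t ≤ n, min (q * θ t / 8) (8 / (q * θ t)))) ≤
      (1 - q) ^ B.card := by
    have hBr : (B.card : ℝ) ≤ ∑ t with θ t ≤ n, (θ t : ℝ) := by exact_mod_cast hB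
    have hmin : ∑ t with θ t ≤ n, min (q * θ t / 8) (8 / (q * θ t)) =
        q / 8 * ∑ t with θ t ≤ n, (θ t : ℝ) := by
      rw [Finset.mul_sum]
      refine Finset.sum_congr rfl fun t ht => ?_
      have htn : (θ t : ℝ) ≤ n := by exact_mod_cast (Finset.mem_filter.1 ht).2
      rw [min_eq_left]
      · ring
      · rcases Nat.eq_zero_or_pos (θ t) with h | h
        · simp [h]
        · have hpos : 0 < q * θ t := mul_pos h0 (by exact_mod_cast h)
          have : q * θ t ≤ 8 := by nlinarith
          rw [div_le_div_iff₀ (by norm_num) hpos]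
          nlinarith
    calc _ ≤ Real.exp (B.card * (-(2 * q))) := by
          rw [Real.exp_le_exp, hmin]
          nlinarith
      _ = Real.exp (-(2 * q)) ^ B.card := Real.exp_nat_mul _ _
      _ ≤ _ := by
          gcongr
          exact exp_neg_two_mul_le_one_sub h0.le h1
  have hhigh : Real.exp (-(16 * ∑ t with ¬ θ t ≤ n, min (q * θ t / 8) (8 / (q * θ t)))) ≤
      bernoulliProb p (⋂ t ∈ s, E t) := by
    refine le_trans ?_ (prod_bernoulliProb_le hp0 hp1 s E hupper)
    rw [Finset.mul_sum, ← Finset.sum_neg_distrib, Real.exp_sum]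
    refine Finset.prod_le_prod (fun _ _ => (Real.exp_pos _).le) fun t ht => ?_
    have htn : n < θ t := not_le.1 (Finset.mem_filter.1 ht).2
    have htn' : (n : ℝ) < θ t := by exact_mod_cast htn
    have hy : 1 ≤ q * θ t / 8 := by
      rw [le_div_iff₀ (by norm_num)]
      nlinarith
    have hinv : 8 / (q * θ t) = 1 / (q * θ t / 8) := by rw [one_div_div]
    have hD : (θ t : ℝ) ≤ (S t \ B).card := by exact_mod_cast habs t htn
    refine le_trans ?_ (one_sub_exp_le_bernoulliProb_two_le (q := q) hp0 hp1 (fun v hv => ?_)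
      (by linarith))
    · rw [hinv, min_eq_right (by
        rw [div_le_iff₀ (by linarith)]
        nlinarith)]
      have hpos : 0 < 1 / (q * θ t / 8) := by positivity
      calc _ ≤ Real.exp (-(1 / (q * θ t / 8))) := by rw [Real.exp_le_exp]; linarith
        _ ≤ 1 - 2 * Real.exp (-(4 * (q * θ t / 8))) := exp_neg_inv_le_one_sub hy
        _ ≤ _ := by
          gcongr
          nlinarith
    · simp [hp, (Finset.mem_sdiff.1 hv).2]
  rw [← Finset.sum_filter_add_sum_filter_not Finset.univ (θ · ≤ n), mul_add, neg_add, Real.exp_add]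
  exact (mul_le_mul hlow hhigh (Real.exp_pos _).le (by
    have : 0 ≤ 1 - q := by linarith
    positivity)).trans hle

/-- Dropping the first term replaces `a` by `a / 2`. The two-case bound, sharper than the `4` needed
later, survives this induction. -/
theorem sum_range_min_div_two_pow_le (I : ℕ) {a : ℝ} (ha : 0 ≤ a) :
    ∑ i ∈ Finset.range I, min (a / 2 ^ i) (2 ^ i / a) ≤ if a ≤ 1 then 2 * a else 4 - 2 / a := by
  induction I generalizing a with
  | zero =>
    split_ifs with h
    · simpa using ha
    · have : 2 / a ≤ 2 := by rw [div_le_iff₀ (by linarith)]; linarith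
      simp only [Finset.range_zero, Finset.sum_empty]
      linarith
  | succ I ih =>
    have hstep : ∀ i, min (a / 2 ^ (i + 1)) (2 ^ (i + 1) / a) =
        min (a / 2 / 2 ^ i) (2 ^ i / (a / 2)) := by
      intro i
      congr 1
      · rw [pow_succ', div_div]
      · rw [pow_succ', div_div_eq_mul_div, mul_comm]
    rw [Finset.sum_range_succ']
    simp only [hstep, pow_zero, div_one]
    have ih' := ih (a := a / 2) (by positivity)
    by_cases h1 : a ≤ 1
    · rw [if_pos (by linarith)] at ih'
      rw [if_pos h1]
      linarith [min_le_left a (1 / a)]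
    · have ha0 : 0 < a := by linarith
      rw [if_neg h1]
      by_cases h2 : a ≤ 2
      · rw [if_pos (by linarith)] at ih'
        have h3 : a + 3 / a ≤ 4 := by
          rw [← sub_nonneg]
          have : 4 - (a + 3 / a) = (a - 1) * (3 - a) / a := by field_simp; ring
          rw [this]
          exact div_nonneg (mul_nonneg (by linarith) (by linarith)) ha0.le
        have h4 : 3 / a = 1 / a + 2 / a := by ring
        linarith [min_le_right a (1 / a)]
      · rw [if_neg (by linarith)] at ih'
        have h3 : 2 / (a / 2) = 4 / a := by field_simp; norm_num
        have h4 : 4 / a = 1 / a + 2 / a + 1 / a := by ring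
        have h5 : 0 < 1 / a := by positivity
        linarith [min_le_right a (1 / a)]

/-- Among any `I` consecutive scales there is one for which a random set is likely to hit no member
of the family exactly once. -/
theorem exists_scale_bernoulliProb_hitNoneOnce (S : τ → Finset α) {i₀ I : ℕ} (hi₀ : 1 ≤ i₀)
    (hI : 1 ≤ I) : ∃ i ∈ Finset.Ico i₀ (i₀ + I),
      Real.exp (-(64 * Fintype.card τ / I)) ≤
        bernoulliProb (fun _ => (1 / 2 : ℝ) ^ i) (hitNoneOnce S) := by
  -- One level function serves all scales, so the costs can be summed over the scales for each slot
  -- separately.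
  obtain ⟨θ, hθ⟩ := exists_levels S
  let cost : ℕ → ℝ := fun i =>
    16 * ∑ t, min ((1 / 2 : ℝ) ^ i * θ t / 8) (8 / ((1 / 2 : ℝ) ^ i * θ t))
  have hcost : ∑ i ∈ Finset.Ico i₀ (i₀ + I), cost i ≤ 64 * Fintype.card τ := by
    have hnonneg : ∀ (i : ℕ) (t : τ),
        0 ≤ min ((1 / 2 : ℝ) ^ i * θ t / 8) (8 / ((1 / 2 : ℝ) ^ i * θ t)) :=
      fun i t => le_min (by positivity) (by positivity)
    calc ∑ i ∈ Finset.Ico i₀ (i₀ + I), cost i ≤ ∑ i ∈ Finset.range (i₀ + I), cost i :=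
          Finset.sum_le_sum_of_subset_of_nonneg (by
            intro i hi
            simp only [Finset.mem_Ico, Finset.mem_range] at hi ⊢
            exact hi.2) fun i _ _ =>
            mul_nonneg (by norm_num) (Finset.sum_nonneg fun t _ => hnonneg i t)
      _ = 16 * ∑ t, ∑ i ∈ Finset.range (i₀ + I), min ((θ t / 8 : ℝ) / 2 ^ i) (2 ^ i / (θ t / 8)) := by
          simp only [cost, ← Finset.mul_sum]
          rw [Finset.sum_comm]
          congr 1
          refine Finset.sum_congr rfl fun t _ => Finset.sum_congr rfl fun i _ => ?_
          congr 1
          · rw [one_div, inv_pow]; ring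
          · rw [one_div, inv_pow]
            field_simp
      _ ≤ 16 * ∑ t : τ, 4 := by
          gcongr with t
          refine (sum_range_min_div_two_pow_le _ (by positivity)).trans ?_
          split_ifs with h
          · linarith
          · have : (0 : ℝ) ≤ 2 / (θ t / 8) := by positivity
            linarith
      _ = 64 * Fintype.card τ := by
          simp only [Finset.sum_const, Finset.card_univ, nsmul_eq_mul]
          ring
  have hI0 : (0 : ℝ) < I := by exact_mod_cast hI
  obtain ⟨i, hi, hle⟩ := Finset.exists_le_of_sum_le (s := Finset.Ico i₀ (i₀ + I)) (f := cost)
    (g := fun _ => 64 * Fintype.card τ / I) (by simpa using by omega) (by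
      simp only [Finset.sum_const, Nat.card_Ico, add_tsub_cancel_left, nsmul_eq_mul]
      rwa [mul_div_cancel₀ _ hI0.ne'])
  refine ⟨i, hi, le_trans ?_ (exp_le_bernoulliProb_hitNoneOnce (hθ (8 * 2 ^ i)) (by positivity) ?_ ?_)⟩
  · rw [Real.exp_le_exp, neg_le_neg_iff]
    exact hle
  · have hi1 : 1 ≤ i := hi₀.trans (Finset.mem_Ico.1 hi).1
    simpa using pow_le_pow_of_le_one (by norm_num : (0 : ℝ) ≤ 1 / 2) (by norm_num) hi1
  · push_cast
    rw [one_div, inv_pow]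
    field_simp

end Bernoulli

/-! ### No collision detection -/

/-- Exchanges the two averages: a bound over random stars for each fixed seed assignment becomes a
bound on failure probabilities. -/
theorem le_sum_mul_measureReal {Ω κ : Type} [MeasurableSpace Ω] (μ : Measure Ω)
    [IsProbabilityMeasure μ] (J : Finset κ) (w : κ → ℝ) (E : κ → Set Ω)
    (hE : ∀ j ∈ J, MeasurableSet (E j)) {δ : ℝ}
    (h : ∀ r, δ ≤ ∑ j ∈ J, w j * (E j).indicator 1 r) : δ ≤ ∑ j ∈ J, w j * μ.real (E j) := by
  have hint : ∀ j ∈ J, Integrable (fun r => w j * (E j).indicator (1 : Ω → ℝ) r) μ := fun j hj =>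
    ((integrable_const (1 : ℝ)).indicator (hE j hj)).const_mul _
  calc δ = ∫ _, δ ∂μ := by simp
    _ ≤ ∫ r, ∑ j ∈ J, w j * (E j).indicator 1 r ∂μ :=
        integral_mono (integrable_const _) (integrable_finsetSum _ hint) h
    _ = ∑ j ∈ J, w j * μ.real (E j) := by
        rw [integral_finsetSum _ hint]
        refine Finset.sum_congr rfl fun j hj => ?_
        rw [integral_const_mul, integral_indicator_one (hE j hj)]

variable {A : Algorithm}

/-- The leaves that broadcast in slot `t` if the center hears nothing but silence. -/
def broadcasters {α : Type} [Fintype α] (A : Algorithm) (r : Option α → A.Seed) (t : ℕ) :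
    Finset α :=
  Finset.univ.filter fun v =>
    (A.act (r (some v)) (pairRun A false (r none) (r (some v)) t).2).isSome

theorem history_star_of_mem_hitNoneOnce {α : Type} [Fintype α] [DecidableEq α] {T : ℕ}
    {r : Option α → A.Seed} {R : Finset α} (hR : R.Nonempty)
    (h : R ∈ hitNoneOnce fun t : Fin T => broadcasters A r t) :
    history A false (star R) r T none = (pairRun A false (r none) (r none) T).1 := by
  obtain ⟨v, hv⟩ := hR
  refine ((history_star (fun _ _ _ _ => pairRun_false_fst T) (fun t ht v hv _ hs => ?_)
    le_rfl hv).1).trans (pairRun_false_fst T)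
  have hmem : v ∈ R ∩ broadcasters A r t :=
    Finset.mem_inter.2 ⟨hv, by simpa [broadcasters, Option.isSome_iff_ne_none] using hs⟩
  have hpos := Finset.card_pos.2 ⟨v, hmem⟩
  have hne : (R ∩ broadcasters A r t).card ≠ 1 := h ⟨t, ht⟩
  have hone : 1 < (R ∩ broadcasters A r t).card := by omega
  obtain ⟨w, hw, hwv⟩ := Finset.exists_mem_ne hone v
  rw [Finset.mem_inter] at hw
  exact ⟨w, hw.1, hwv, by simpa [broadcasters, Option.isSome_iff_ne_none] using hw.2⟩

/-- In each of two blocks of scales some scale makes it likely that the center hears nothing, and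
then its estimate is wrong for at least one of the two scales. -/
theorem exp_sub_le_sum_bernoulliWeight {α : Type} [Fintype α] [DecidableEq α] {c : ℝ} {L I g e T : ℕ}
    (hα : Fintype.card α = 2 ^ L) (hc : 0 ≤ c) (hI : 1 ≤ I) (hg : 12 * c ≤ 2 ^ g) (he4 : 4 ≤ e)
    (hL : 2 * I + g ≤ L) (he : e ≤ 2 ^ (L - (2 * I + g))) (r : Option α → A.Seed) :
    Real.exp (-(64 * T / I)) - 2 * (4 / 5) ^ e ≤
      ∑ j ∈ Finset.Ico 1 (1 + (2 * I + g)) ×ˢ (Finset.univ : Finset (Finset α)),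
        bernoulliWeight (fun _ => (1 / 2 : ℝ) ^ j.1) j.2 *
          {r | 2 ≤ j.2.card ∧ ¬ GoodEstimate A false (star j.2) c T r none}.indicator 1 r := by
  set S : Fin T → Finset α := fun t => broadcasters A r t with hS
  have hq0 : ∀ i : ℕ, (0 : ℝ) ≤ (1 / 2) ^ i := fun i => by positivity
  have hq1 : ∀ i : ℕ, (1 / 2 : ℝ) ^ i ≤ 1 := fun i => pow_le_one₀ (by norm_num) (by norm_num)
  -- Silent sets whose size lies strictly between a quarter of and three times the mean `2 ^ (L -
  -- i)`.
  set Q : ℕ → Set (Finset α) := fun i =>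
    (hitNoneOnce S \ {R | 3 * 2 ^ (L - i) ≤ R.card}) \ {R | 4 * R.card ≤ 2 ^ (L - i)} with hQ
  have hprob : ∀ i ≤ 2 * I + g,
      Real.exp (-(64 * T / I)) ≤ bernoulliProb (fun _ => (1 / 2 : ℝ) ^ i) (hitNoneOnce S) →
      Real.exp (-(64 * T / I)) - 2 * (4 / 5) ^ e ≤ bernoulliProb (fun _ => (1 / 2 : ℝ) ^ i) (Q i) := by
    intro i hi hP
    have hcard : (1 / 2 : ℝ) ^ i * Fintype.card α = ((2 ^ (L - i) : ℕ) : ℝ) := by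
      rw [hα]
      push_cast
      rw [pow_sub₀ _ (by norm_num) (hi.trans hL), one_div, inv_pow, mul_comm]
    have hei : e ≤ 2 ^ (L - i) := he.trans (Nat.pow_le_pow_right (by norm_num) (by omega))
    have hpow : (4 / 5 : ℝ) ^ 2 ^ (L - i) ≤ (4 / 5) ^ e :=
      pow_le_pow_of_le_one (by norm_num) (by norm_num) hei
    have h1 := bernoulliProb_sub_le (fun _ : α => hq0 i) (fun _ => hq1 i) (hitNoneOnce S)
      {R | 3 * 2 ^ (L - i) ≤ R.card}
    have h2 := bernoulliProb_sub_le (fun _ : α => hq0 i) (fun _ => hq1 i)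
      (hitNoneOnce S \ {R | 3 * 2 ^ (L - i) ≤ R.card}) {R | 4 * R.card ≤ 2 ^ (L - i)}
    have h3 := bernoulliProb_three_mul_le_card (hq0 i) (hq1 i) hcard
    have h4 := bernoulliProb_four_mul_card_le (hq0 i) (hq1 i) hcard
    simp only [hQ]
    linarith
  have hwindow : ∀ i ≤ 2 * I + g, ∀ R ∈ Q i, R ∈ hitNoneOnce S ∧ R.card < 3 * 2 ^ (L - i) ∧
      2 ^ (L - i) < 4 * R.card ∧ 2 ≤ R.card := by
    intro i hi R hR
    have h1 : ¬ 3 * 2 ^ (L - i) ≤ R.card := hR.1.2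
    have h2 : ¬ 4 * R.card ≤ 2 ^ (L - i) := hR.2
    have hei : e ≤ 2 ^ (L - i) := he.trans (Nat.pow_le_pow_right (by norm_num) (by omega))
    exact ⟨hR.1.1, by omega, by omega, by omega⟩
  suffices hbad : ∃ i ∈ Finset.Ico 1 (1 + (2 * I + g)),
      Real.exp (-(64 * T / I)) - 2 * (4 / 5) ^ e ≤ bernoulliProb (fun _ => (1 / 2 : ℝ) ^ i) (Q i) ∧
      ∀ R ∈ Q i, ¬ GoodEstimate A false (star R) c T r none by
    obtain ⟨i, hi, hP, hR⟩ := hbad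
    rw [Finset.sum_product]
    have hterm : ∀ (i : ℕ) (R : Finset α) (E : Set (Option α → A.Seed)),
        0 ≤ bernoulliWeight (fun _ => (1 / 2 : ℝ) ^ i) R * E.indicator 1 r := fun i R E =>
      mul_nonneg (bernoulliWeight_nonneg (fun _ => hq0 i) (fun _ => hq1 i) R)
        (Set.indicator_nonneg (fun _ _ => zero_le_one) r)
    refine hP.trans (le_trans ?_ (Finset.single_le_sum
      (fun i _ => Finset.sum_nonneg fun R _ => hterm i R _) hi))
    refine Finset.sum_le_sum fun R _ => ?_
    by_cases hRQ : R ∈ Q i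
    · rw [Set.indicator_of_mem hRQ, Set.indicator_of_mem]
      · simp
      · exact ⟨(hwindow i (by rw [Finset.mem_Ico] at hi; omega) R hRQ).2.2.2, hR R hRQ⟩
    · rw [Set.indicator_of_notMem hRQ, mul_zero]
      exact hterm i R _
  obtain ⟨i₁, hi₁, hP₁⟩ := exists_scale_bernoulliProb_hitNoneOnce S le_rfl hI
  obtain ⟨i₂, hi₂, hP₂⟩ := exists_scale_bernoulliProb_hitNoneOnce S (i₀ := 1 + (I + g)) (by omega) hI
  rw [Fintype.card_fin] at hP₁ hP₂
  rw [Finset.mem_Ico] at hi₁ hi₂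
  by_contra hcon
  push Not at hcon
  obtain ⟨R₁, hR₁, hgood₁⟩ := hcon i₁ (by rw [Finset.mem_Ico]; omega) (hprob i₁ (by omega) hP₁)
  obtain ⟨R₂, hR₂, hgood₂⟩ := hcon i₂ (by rw [Finset.mem_Ico]; omega) (hprob i₂ (by omega) hP₂)
  obtain ⟨hs₁, -, hlow, h2₁⟩ := hwindow i₁ (by omega) R₁ hR₁
  obtain ⟨hs₂, hhigh, -, h2₂⟩ := hwindow i₂ (by omega) R₂ hR₂
  obtain ⟨x, hx, hx1, -⟩ := hgood₁
  obtain ⟨y, hy, -, hy2⟩ := hgood₂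
  rw [history_star_of_mem_hitNoneOnce (Finset.card_pos.1 (by omega)) hs₁] at hx
  rw [history_star_of_mem_hitNoneOnce (Finset.card_pos.1 (by omega)) hs₂, hx] at hy
  obtain rfl : x = y := by simpa using hy
  rw [star_neighborSet_none_ncard] at hx1 hy2
  have hlow' : (2 : ℝ) ^ (L - i₁) < 4 * R₁.card := by exact_mod_cast hlow
  have hhigh' : (R₂.card : ℝ) < 3 * 2 ^ (L - i₂) := by exact_mod_cast hhigh
  -- The size windows lose the factors `4` and `3`, so a gap with `12 * c ≤ 2 ^ g` makes the sizes
  -- incompatible with one estimate.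
  have hgap : (2 : ℝ) ^ g * 2 ^ (L - i₂) ≤ 2 ^ (L - i₁) := by
    rw [← pow_add]
    exact pow_le_pow_right₀ (by norm_num) (by omega)
  have h1 : 12 * c * 2 ^ (L - i₂) ≤ 2 ^ g * (2 : ℝ) ^ (L - i₂) :=
    mul_le_mul_of_nonneg_right hg (by positivity)
  have h2 : c * R₂.card ≤ c * (3 * 2 ^ (L - i₂)) := mul_le_mul_of_nonneg_left hhigh'.le hc
  linarith

/-- The weights sum to `1` at each scale, so the failures cost `ε` per scale rather than per star.
-/
theorem exp_sub_le_of_solves {c : ℝ} {L I g e N T : ℕ} {ε : ℝ} (hε : 0 ≤ ε)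
    (hA : SolvesAllNodesCounting A false c N T (1 - ε)) (hN : 2 ^ L + 1 ≤ N)
    (hc : 0 ≤ c) (hI : 1 ≤ I) (hg : 12 * c ≤ 2 ^ g) (he4 : 4 ≤ e)
    (hL : 2 * I + g ≤ L) (he : e ≤ 2 ^ (L - (2 * I + g))) :
    Real.exp (-(64 * T / I)) - 2 * (4 / 5) ^ e ≤ (2 * I + g) * ε := by
  have hle := le_sum_mul_measureReal (Measure.pi fun _ : Option (Fin (2 ^ L)) => A.law)
    (Finset.Ico 1 (1 + (2 * I + g)) ×ˢ (Finset.univ : Finset (Finset (Fin (2 ^ L)))))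
    (fun j => bernoulliWeight (fun _ => (1 / 2 : ℝ) ^ j.1) j.2)
    (fun j => {r | 2 ≤ j.2.card ∧ ¬ GoodEstimate A false (star j.2) c T r none})
    (fun j _ => (MeasurableSet.const _).inter
      (measurableSet_goodEstimate A false (star j.2) c T none).compl)
    (exp_sub_le_sum_bernoulliWeight (by simp) hc hI hg he4 hL he)
  refine hle.trans ?_
  calc _ ≤ ∑ j ∈ Finset.Ico 1 (1 + (2 * I + g)) ×ˢ (Finset.univ : Finset (Finset (Fin (2 ^ L)))),
        bernoulliWeight (fun _ => (1 / 2 : ℝ) ^ j.1) j.2 * ε := by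
        refine Finset.sum_le_sum fun j _ => mul_le_mul_of_nonneg_left ?_
          (bernoulliWeight_nonneg (fun _ => by positivity)
            (fun _ => pow_le_one₀ (by norm_num) (by norm_num)) _)
        by_cases h2 : 2 ≤ j.2.card
        · simp only [h2, true_and]
          have := Finset.card_le_univ j.2
          rw [Fintype.card_fin] at this
          exact hA.measure_star_le j.2 h2 (by omega)
        · simpa [h2] using hε
    _ = (2 * I + g) * ε := by
        rw [Finset.sum_product]
        simp only [← Finset.sum_mul, sum_bernoulliWeight]
        simp

theorem eventually_mul_pow_add_lt_one :
    ∀ᶠ L : ℕ in Filter.atTop, (L : ℝ) * (4 / 7) ^ L + 2 * (32 / 35) ^ L < 1 := by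
  have h1 := tendsto_self_mul_const_pow_of_lt_one (r := (4 / 7 : ℝ)) (by norm_num) (by norm_num)
  have h2 := (tendsto_pow_atTop_nhds_zero_of_lt_one (r := (32 / 35 : ℝ)) (by norm_num)
    (by norm_num)).const_mul 2
  have h3 := h1.add h2
  rw [mul_zero, add_zero] at h3
  exact h3.eventually (gt_mem_nhds one_pos)

theorem noCollisionDetection_lower_bound (cTilde : ℝ) (hc : 1 ≤ cTilde) :
    ∃ c : ℝ, 0 < c ∧ ∃ N₀ : ℕ, ∀ N : ℕ, N₀ ≤ N → ∀ γ : ℝ, 1 ≤ γ →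
      ∀ (A : Algorithm) (T : ℕ),
        SolvesAllNodesCounting A false cTilde N T (1 - 1 / (N : ℝ) ^ γ) →
          c * Real.logb 2 N ^ 2 ≤ T := by
  obtain ⟨g, hg⟩ := pow_unbounded_of_one_lt (12 * cTilde) (one_lt_two (α := ℝ))
  obtain ⟨L₀, hL₀⟩ := Filter.eventually_atTop.1 eventually_mul_pow_add_lt_one
  -- Here `32768 = 8 * 4 * 64 * 16`: target exponent `L / 8`, `logb 2 N ≤ 2 * L` squared, the factor
  -- `64`, and `L ≤ 16 * I`. The final `+ 1` in the threshold leaves room for the center.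
  refine ⟨1 / 32768, by norm_num, 2 ^ (L₀ + 4 * g + 8) + 1, fun N hN γ hγ A T hA => ?_⟩
  by_contra! hT
  set L := Nat.log 2 (N - 1) with hLdef
  have hNpos : N - 1 ≠ 0 := by
    have := Nat.one_le_two_pow (n := L₀ + 4 * g + 8)
    omega
  have hLlow : L₀ + 4 * g + 8 ≤ L := Nat.le_log_of_pow_le (by norm_num) (by omega)
  have hLN : 2 ^ L ≤ N - 1 := Nat.pow_log_le_self 2 hNpos
  have hNL : N ≤ 2 ^ (L + 1) := by
    have := Nat.lt_pow_succ_log_self (b := 2) (by norm_num) (N - 1)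
    rw [Nat.succ_eq_add_one, ← hLdef] at this
    omega
  set I := L / 8 with hI
  have hpow : L ≤ 2 ^ (L - (2 * I + g)) := by
    obtain ⟨k, hk⟩ : ∃ k, L - (2 * I + g) = k + 1 := ⟨L - (2 * I + g) - 1, by omega⟩
    have := Nat.lt_two_pow_self (n := k)
    rw [hk, pow_succ]
    omega
  have key := exp_sub_le_of_solves (e := L) (by positivity)
    (hA.of_one_le_exponent (by omega) hγ) (by omega) (by linarith) (by omega : 1 ≤ I) hg.le
    (by omega) (by omega) hpow
  have hL0 : (0 : ℝ) < L := by exact_mod_cast (by omega : 0 < L)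
  have hI0 : (L : ℝ) ≤ 16 * I := by exact_mod_cast (by omega : L ≤ 16 * I)
  have hJ : (2 * I + g : ℝ) ≤ L := by exact_mod_cast (by omega : 2 * I + g ≤ L)
  have hN0 : (0 : ℝ) < N := by exact_mod_cast (by omega : 0 < N)
  have hε : 1 / (N : ℝ) ≤ (1 / 2) ^ L := by
    rw [one_div_pow]
    exact one_div_le_one_div_of_le (by positivity) (by exact_mod_cast (by omega : 2 ^ L ≤ N))
  have hlog : Real.logb 2 N ≤ 2 * L := by
    rw [Real.logb_le_iff_le_rpow (by norm_num) hN0]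
    have h1 : (N : ℝ) ≤ 2 ^ (2 * L) := by
      exact_mod_cast hNL.trans (Nat.pow_le_pow_right (by norm_num) (by omega))
    have h2 : (2 * L : ℝ) = ((2 * L : ℕ) : ℝ) := by push_cast; ring
    rwa [h2, Real.rpow_natCast]
  have hlog0 : 0 ≤ Real.logb 2 N :=
    Real.logb_nonneg (by norm_num) (by exact_mod_cast (by omega : 1 ≤ N))
  have hTL : (64 * T / I : ℝ) ≤ L / 8 := by
    rw [div_le_iff₀ (by linarith)]
    have : Real.logb 2 N ^ 2 ≤ (2 * L) ^ 2 := by gcongr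
    nlinarith
  have hexp : Real.exp (-(1 / 8 : ℝ)) ^ L ≤ L * (1 / 2) ^ L + 2 * (4 / 5) ^ L := by
    have h1 : Real.exp (-(1 / 8 : ℝ)) ^ L ≤ Real.exp (-(64 * T / I)) := by
      rw [← Real.exp_nat_mul, Real.exp_le_exp]
      linarith
    have h2 : (2 * I + g : ℝ) * (1 / N) ≤ L * (1 / 2) ^ L := by gcongr
    linarith
  have h78 : (7 / 8 : ℝ) ^ L ≤ Real.exp (-(1 / 8 : ℝ)) ^ L := by
    gcongr
    linarith [Real.add_one_le_exp (-(1 / 8) : ℝ)]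
  have hlt := hL₀ L (by omega)
  -- Division by `(7 / 8) ^ L`, a lower bound for the success probability, leaves the decaying
  -- ratios `4 / 7` and `32 / 35`.
  have e1 : (1 / 2 : ℝ) ^ L = (4 / 7) ^ L * (7 / 8) ^ L := by rw [← mul_pow]; norm_num
  have e2 : (4 / 5 : ℝ) ^ L = (32 / 35) ^ L * (7 / 8) ^ L := by rw [← mul_pow]; norm_num
  rw [e1, e2] at hexp
  have hpos : (0 : ℝ) < (7 / 8) ^ L := by positivity
  nlinarith

end RadioNetwork

theorem mainTheorem4 (cTilde : ℝ) (hc : 1 ≤ cTilde) :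
    (∃ c : ℝ, 0 < c ∧ ∃ N₀ : ℕ, ∀ N : ℕ, N₀ ≤ N → ∀ γ : ℝ, 1 ≤ γ →
      ∀ (A : RadioNetwork.Algorithm) (T : ℕ),
        RadioNetwork.SolvesAllNodesCounting A false cTilde N T (1 - 1 / (N : ℝ) ^ γ) →
          c * Real.logb 2 N ^ 2 ≤ T) ∧
    (∃ c : ℝ, 0 < c ∧ ∃ N₀ : ℕ, ∀ N : ℕ, N₀ ≤ N → ∀ γ : ℝ, 1 ≤ γ →
      ∀ (A : RadioNetwork.Algorithm) (T : ℕ),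
        RadioNetwork.SolvesAllNodesCounting A true cTilde N T (1 - 1 / (N : ℝ) ^ γ) →
          c * Real.logb 2 N ≤ T) := by
  exact ⟨RadioNetwork.noCollisionDetection_lower_bound cTilde hc,
    RadioNetwork.collisionDetection_lower_bound cTilde⟩
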